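/- Let $\mathcal{G}$ be a locally compact étale groupoid: a groupoid with unit space $\mathcal{G}^{(0)}\subseteq\mathcal{G}$, endowed with a locally compact Hausdorff topology for which composition, inversion, source $\mathrm{s}$ and range $\mathrm{r}$ are continuous and $\mathrm{r}:\mathcal{G}\to\mathcal{G}^{(0)}$ is a local homeomorphism ($\mathcal{G}^{(0)}$ has the subspace topology). For $x\in\mathcal{G}^{(0)}$ put $\mathcal{G}_x=\mathrm{s}^{-1}(x)$. Let $L^2(\mathcal{G})$ be the Hilbert $C_0(\mathcal{G}^{(0)})$-module obtained by completing $C_c(\mathcal{G})$ with respect to the inner product $\langle\eta,\xi\rangle(x)=\sum_{\gamma\in\mathcal{G}_x}\overline{\eta(\gamma)}\,\xi(\gamma)$, with right action $(\xi f)(\gamma)=\xi(\gamma)f(\mathrm{s}(\gamma))$. Its elements are continuous functions on $\mathcal{G}$ with restrictions $\xi|_{\mathcal{G}_x}\in\ell^2(\mathcal{G}_x)$. A map $S:L^2(\mathcal{G})\to L^2(\mathcal{G})$ is adjointable if there is a map $S^*:L^2(\mathcal{G})\to L^2(\mathcal{G})$ with $\langle\eta,S\xi\rangle=\langle S^*\eta,\xi\rangle$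 for all $\xi,\eta$. The slice of an adjointable $S$ at $x$ is the bounded operator $\Phi_x(S)$ on $\ell^2(\mathcal{G}_x)$ determined by $\Phi_x(S)(\xi|_{\mathcal{G}_x})=(S\xi)|_{\mathcal{G}_x}$ for $\xi\in L^2(\mathcal{G})$. The operator fibre space is the disjoint union $E=\bigsqcup_{x\in\mathcal{G}^{(0)}}\mathscr{B}(\ell^2(\mathcal{G}_x))$ with the topology in which a net $\sigma_{x_i}\in\mathscr{B}(\ell^2(\mathcal{G}_{x_i}))$ converges to $\sigma_x\in\mathscr{B}(\ell^2(\mathcal{G}_x))$ if and only if $x_i\to x$ and, whenever $\gamma_i'\to\gamma'$ and $\gamma_i''\to\gamma''$ in $\mathcal{G}$ with $\mathrm{s}(\gamma_i')=x_i=\mathrm{s}(\gamma_i'')$, one has $\langle\delta_{\gamma_i''},\sigma_{x_i}\delta_{\gamma_i'}\rangle\to\langle\delta_{\gamma''},\sigma_x\delta_{\gamma'}\rangle$. A family $(T_x)_{x\in\mathcal{G}^{(0)}}$ of operators $T_x\in\mathscr{B}(\ell^2(\mathcal{G}_x))$ is called vector-wise uniformly quasi-local if for every $\varepsilon>0$ and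 $\xi\in C_c(\mathcal{G})$ there is a compact set $K\subseteq\mathcal{G}$ such that for all $x\in\mathcal{G}^{(0)}$ and all $A_x,B_x\subseteq\mathcal{G}_x$ with $A_x\cap(KB_x)=\emptyset$ one has $\|(\chi_{A_x}T_x\chi_{B_x})(\xi|_{\mathcal{G}_x})\|<\varepsilon$. Here $\chi_{A}$ is multiplication by the characteristic function of $A$, and $KB_x=\{\gamma_1\gamma_2:\gamma_1\in K,\ \gamma_2\in B_x,\ \mathrm{s}(\gamma_1)=\mathrm{r}(\gamma_2)\}$. **Theorem.** Let $T_x\in\mathscr{B}(\ell^2(\mathcal{G}_x))$ for $x\in\mathcal{G}^{(0)}$, with $\sup_{x}\|T_x\|<\infty$. The following are equivalent: 1. there is an adjointable operator $S$ on $L^2(\mathcal{G})$ with $\Phi_x(S)=T_x$ for all $x\in\mathcal{G}^{(0)}$; 2. the map $x\mapsto T_x$ is a continuous section of $E$, and both $(T_x)_{x\in\mathcal{G}^{(0)}}$ and $(T_x^*)_{x\in\mathcal{G}^{(0)}}$ are vector-wise uniformly quasi-local. -/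

import Mathlib

universe u v

namespace EtaleGroupoid

open CategoryTheory Topology Set Filter
open scoped ZeroAtInfty CompactlySupported ENNReal

/-- The total space `𝒢` of all arrows of a groupoid with object set `X`. -/
abbrev Arrows (X : Type u) [Groupoid.{v} X] : Type (max u v) := Quiver.Total.{v} X

section Algebra

variable {X : Type u} [Groupoid.{v} X]

/-- The source map `s : 𝒢 → 𝒢⁽⁰⁾`. -/
def source (γ : Arrows X) : X := γ.left

/-- The range map `r : 𝒢 → 𝒢⁽⁰⁾`. -/
def range (γ : Arrows X) : X := γ.right

/-- The unit arrow at an object; it identifies the objects with the unit space `𝒢⁽⁰⁾ ⊆ 𝒢`. -/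
def unit (x : X) : Arrows X := ⟨x, x, 𝟙 x⟩

/-- The inverse `γ⁻¹` of an arrow. -/
def inverse (γ : Arrows X) : Arrows X := ⟨γ.right, γ.left, Groupoid.inv γ.hom⟩

/-- The product `γ₁γ₂` of two arrows with `s γ₁ = r γ₂` (first `γ₂`, then `γ₁`). -/
def product (γ₁ γ₂ : Arrows X) (h : source γ₁ = range γ₂) : Arrows X :=
  ⟨γ₂.left, γ₁.right, γ₂.hom ≫ eqToHom h.symm ≫ γ₁.hom⟩

/-- `AB = {γ₁γ₂ : γ₁ ∈ A, γ₂ ∈ B, s γ₁ = r γ₂}`. -/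
def setProduct (A B : Set (Arrows X)) : Set (Arrows X) :=
  {γ | ∃ γ₁ ∈ A, ∃ γ₂ ∈ B, ∃ h : source γ₁ = range γ₂, γ = product γ₁ γ₂ h}

/-- The source fibre `𝒢_x = s⁻¹(x)`. -/
abbrev Fibre (x : X) : Type (max u v) := {γ : Arrows X // source γ = x}

/-- The Hilbert space `ℓ²(𝒢_x)`. -/
noncomputable abbrev ell2 (x : X) := lp (fun _ : Fibre x => ℂ) 2

theorem inverse_inverse (γ : Arrows X) : inverse (inverse γ) = γ := by
  cases γ; simp [inverse]

end Algebra

/-- The Banach space `∏_x ℓ²(𝒢_x)` of uniformly bounded families of vectors. -/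
noncomputable abbrev ell2Family (X : Type u) [Groupoid.{v} X] := lp (fun x : X => ell2 x) ∞

/-- A locally compact (Hausdorff) groupoid: the arrow space carries a locally compact Hausdorff
topology, the topology of the objects is that of the unit space `𝒢⁽⁰⁾ ⊆ 𝒢`, and composition,
inversion, source and range are continuous. -/
class LocallyCompactGroupoid (X : Type u) [TopologicalSpace X] [Groupoid.{v} X]
    [TopologicalSpace (Arrows X)] : Prop where
  t2Space : T2Space (Arrows X)
  locallyCompactSpace : LocallyCompactSpace (Arrows X)
  isEmbedding_unit : IsEmbedding (unit : X → Arrows X)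
  continuous_source : Continuous (source : Arrows X → X)
  continuous_range : Continuous (range : Arrows X → X)
  continuous_inverse : Continuous (inverse : Arrows X → Arrows X)
  continuous_product : Continuous
    (fun p : {p : Arrows X × Arrows X // source p.1 = range p.2} => product p.1.1 p.1.2 p.2)

/-- A locally compact étale groupoid: the range map is a local homeomorphism onto the unit space. -/
class LocallyCompactEtaleGroupoid (X : Type u) [TopologicalSpace X] [Groupoid.{v} X]
    [TopologicalSpace (Arrows X)] : Prop extends LocallyCompactGroupoid X where
  isLocalHomeomorph_range : IsLocalHomeomorph (range : Arrows X → X)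

theorem norm_inner_self {E : Type*} [NormedAddCommGroup E] [InnerProductSpace ℂ E] (v : E) :
    ‖inner ℂ v v‖ = ‖v‖ ^ 2 := by
  rw [inner_self_eq_norm_sq_to_K]
  simp

theorem exists_c0_of_approx {Y : Type*} [TopologicalSpace Y] (g : Y → ℂ) (h : ∀ ε > 0, ∃ f : C₀(Y, ℂ), ∀ x, ‖g x - f x‖ ≤ ε) :
    ∃ f : C₀(Y, ℂ), ∀ x, f x = g x := by
  have hc : Continuous g := by
    refine continuous_of_uniform_approx_of_continuous fun u hu => ?_
    obtain ⟨ε, hε, hεu⟩ := Metric.mem_uniformity_dist.1 hu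
    obtain ⟨f, hf⟩ := h (ε / 2) (half_pos hε)
    refine ⟨f, map_continuous f, fun y => hεu ?_⟩
    rw [dist_eq_norm]
    linarith [hf y]
  refine ⟨⟨⟨g, hc⟩, ?_⟩, fun x => rfl⟩
  rw [Metric.tendsto_nhds]
  intro ε hε
  obtain ⟨f, hf⟩ := h (ε / 2) (half_pos hε)
  have := (Metric.tendsto_nhds.1 f.zero_at_infty') (ε / 2) (half_pos hε)
  filter_upwards [this] with x hx
  rw [dist_zero_right] at hx ⊢
  have h1 := hf x
  have h2 : ‖g x‖ ≤ ‖g x - f x‖ + ‖f x‖ := by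
    simpa using norm_add_le (g x - f x) (f x)
  have h3 : ‖f x‖ < ε / 2 := hx
  change ‖g x‖ < ε
  linarith

theorem tsum_fibre_eq_zero {X : Type u} [Groupoid.{v} X] [TopologicalSpace (Arrows X)]
    (f : Arrows X → ℂ) (x : X) (hx : x ∉ source '' tsupport f) :
    ∑' γ : Fibre x, f γ = 0 := by
  have : ∀ γ : Fibre x, f γ = 0 := fun γ => by
    by_contra h
    exact hx ⟨γ, subset_tsupport _ h, γ.2⟩
  simp [this]

theorem exists_inner_of_mem_closure {X : Type u} [TopologicalSpace X] [Groupoid.{v} X]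
    (η : ell2Family X) (S : Set (ell2Family X))
    (hS : ∀ ξ ∈ S, ∃ f : C₀(X, ℂ), ∀ x, f x = inner ℂ (η x) (ξ x)) :
    ∀ ξ ∈ closure S, ∃ f : C₀(X, ℂ), ∀ x, f x = inner ℂ (η x) (ξ x) := by
  intro ξ hξ
  refine exists_c0_of_approx _ fun ε hε => ?_
  obtain ⟨ξ', hξ', hd⟩ := Metric.mem_closure_iff.1 hξ (ε / (‖η‖ + 1)) (by positivity)
  obtain ⟨f, hf⟩ := hS ξ' hξ'
  refine ⟨f, fun x => ?_⟩
  rw [hf, ← inner_sub_right]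
  have h1 : ‖ξ x - ξ' x‖ ≤ ‖ξ - ξ'‖ := lp.norm_apply_le_norm (by simp) (ξ - ξ') x
  have h2 : ‖η x‖ ≤ ‖η‖ := lp.norm_apply_le_norm (by simp) η x
  rw [dist_eq_norm] at hd
  calc ‖inner ℂ (η x) (ξ x - ξ' x)‖ ≤ ‖η x‖ * ‖ξ x - ξ' x‖ := norm_inner_le_norm _ _
    _ ≤ (‖η‖ + 1) * (ε / (‖η‖ + 1)) := by gcongr <;> linarith
    _ = ε := by field_simp

section Topology

variable {X : Type u} [TopologicalSpace X] [Groupoid.{v} X] [TopologicalSpace (Arrows X)]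
  [LocallyCompactEtaleGroupoid X]

theorem t2Space_objects : T2Space X :=
  have := LocallyCompactGroupoid.t2Space (X := X)
  (LocallyCompactGroupoid.isEmbedding_unit (X := X)).t2Space

theorem isLocalHomeomorph_source : IsLocalHomeomorph (source : Arrows X → X) := by
  have hc := LocallyCompactGroupoid.continuous_inverse (X := X)
  let e : Arrows X ≃ₜ Arrows X :=
    { toFun := inverse, invFun := inverse, left_inv := inverse_inverse,
      right_inv := inverse_inverse, continuous_toFun := hc, continuous_invFun := hc }
  exact (LocallyCompactEtaleGroupoid.isLocalHomeomorph_range (X := X)).comp e.isLocalHomeomorph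

theorem finite_fibre (K : Set (Arrows X)) (hK : IsCompact K) (x : X) :
    {γ : Arrows X | source γ = x ∧ γ ∈ K}.Finite := by
  have hs := isLocalHomeomorph_source (X := X)
  have := t2Space_objects (X := X)
  have hcl : IsClosed {γ : Arrows X | source γ = x} := isClosed_singleton.preimage hs.continuous
  have hc : IsCompact {γ : Arrows X | source γ = x ∧ γ ∈ K} := hK.inter_left hcl
  choose U hUo hmem hinj using fun γ => hs.isLocallyInjective γ
  obtain ⟨t, -, ht⟩ := hc.elim_nhds_subcover U (fun γ _ => (hUo γ).mem_nhds (hmem γ))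
  refine (t.finite_toSet.biUnion (t := fun γ => {δ | source δ = x} ∩ U γ) ?_).subset ?_
  · intro γ _
    refine Set.Subsingleton.finite ?_
    rintro a ⟨ha, ha'⟩ b ⟨hb, hb'⟩
    exact hinj γ ha' hb' (ha.trans hb.symm)
  · intro δ hδ
    have := ht hδ
    simp only [mem_iUnion] at this ⊢
    obtain ⟨γ, hγ, h⟩ := this
    exact ⟨γ, hγ, hδ.1, h⟩

theorem continuous_fibre_sum (f : Arrows X → ℂ) (hf : Continuous f) (hfc : HasCompactSupport f) :
    Continuous (fun x : X => ∑' γ : Fibre x, f γ) := by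
  classical
  have hs := isLocalHomeomorph_source (X := X)
  have := t2Space_objects (X := X)
  have := LocallyCompactGroupoid.t2Space (X := X)
  rw [continuous_iff_continuousAt]
  intro x₀
  have hfin := finite_fibre (tsupport f) hfc x₀
  obtain ⟨U, hU, hdis⟩ := hfin.t2_separation
  let F := hfin.toFinset
  let e := fun γ : Arrows X => hs.localInverseAt γ
  have hes : ∀ γ y, y ∈ (e γ).source → source (e γ y) = y :=
    fun γ y hy => hs.apply_localInverseAt_of_mem hy
  have hmemF : ∀ γ ∈ F, x₀ ∈ (e γ).source ∧ e γ x₀ = γ := by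
    intro γ hγ
    have h1 : source γ = x₀ := ((hfin.mem_toFinset).1 hγ).1
    refine ⟨?_, ?_⟩
    · rw [← h1]; exact hs.apply_self_mem_localInverseAt_source
    · rw [← h1]; exact hs.localInverseAt_apply_self
  have hcont : ∀ γ ∈ F, ContinuousAt (fun y => e γ y) x₀ :=
    fun γ hγ => (e γ).continuousAt (hmemF γ hγ).1
  have h1 : ∀ᶠ y in 𝓝 x₀, ∀ γ ∈ F, y ∈ (e γ).source ∧ e γ y ∈ U γ := by
    rw [Finset.eventually_all]
    intro γ hγ
    refine Filter.Eventually.and ((e γ).open_source.mem_nhds (hmemF γ hγ).1) ?_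
    refine (hcont γ hγ).eventually_mem ?_
    rw [(hmemF γ hγ).2]
    exact (hU γ).2.mem_nhds (hU γ).1
  let W : Set (Arrows X) := ⋃ γ ∈ F, U γ ∩ (e γ).target
  have hW : IsOpen W := isOpen_biUnion fun γ _ => (hU γ).2.inter (e γ).open_target
  have hC : IsCompact (tsupport f \ W) := hfc.diff hW
  have h2 : ∀ᶠ y in 𝓝 x₀, y ∉ source '' (tsupport f \ W) := by
    refine (hC.image hs.continuous).isClosed.isOpen_compl.mem_nhds ?_
    rintro ⟨δ, ⟨hδ, hδW⟩, h⟩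
    apply hδW
    have : δ ∈ F := hfin.mem_toFinset.2 ⟨h, hδ⟩
    exact mem_biUnion this ⟨(hU δ).1, hs.self_mem_localInverseAt_target⟩
  have key : ∀ᶠ y in 𝓝 x₀, ∑ γ ∈ F, f (e γ y) = ∑' γ : Fibre y, f γ := by
    filter_upwards [h1, h2] with y hy1 hy2
    let j : F → Fibre y := fun γ => ⟨e γ y, hes _ _ (hy1 γ γ.2).1⟩
    have hj : Function.Injective j := by
      intro a b hab
      have hab' : e a y = e b y := congrArg Subtype.val hab
      by_contra hne
      have hne' : (a : Arrows X) ≠ b := fun h => hne (Subtype.ext h)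
      have := hdis (hfin.mem_toFinset.1 a.2) (hfin.mem_toFinset.1 b.2) hne'
      exact this.le_bot ⟨(hy1 a a.2).2, hab' ▸ (hy1 b b.2).2⟩
    have hsupp : Function.support (fun γ : Fibre y => f γ) ⊆ Set.range j := by
      intro δ hδ
      have hδ' : (δ : Arrows X) ∈ tsupport f := subset_tsupport _ hδ
      have : (δ : Arrows X) ∈ W := by
        by_contra h
        exact hy2 ⟨δ, ⟨hδ', h⟩, δ.2⟩
      simp only [W, mem_iUnion] at this
      obtain ⟨γ, hγ, -, ht⟩ := this
      refine ⟨⟨γ, hγ⟩, Subtype.ext ?_⟩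
      have h3 : (e γ) ((e γ).symm δ) = δ := (e γ).right_inv ht
      have h4 : (e γ).symm δ = source (δ : Arrows X) := by
        simp only [e, hs.localInverseAt_symm]
      rw [h4, δ.2] at h3
      exact h3
    rw [← hj.tsum_eq hsupp, tsum_fintype]
    exact (Finset.sum_coe_sort F (fun γ => f (e γ y))).symm
  have hx : ContinuousAt (fun y => ∑ γ ∈ F, f (e γ y)) x₀ := by
    refine tendsto_finsetSum _ fun γ hγ => ?_
    exact (hf.continuousAt.comp (hcont γ hγ))
  exact hx.congr key

/-- A continuous compactly supported function on `𝒢` restricts to a vector `ξ|_{𝒢_x} ∈ ℓ²(𝒢_x)`. -/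
noncomputable def restrict (ξ : C_c(Arrows X, ℂ)) (x : X) : ell2 x :=
  ⟨fun γ => ξ γ, (memℓp_zero (by
    have h := finite_fibre (tsupport ξ) ξ.hasCompactSupport x
    refine Set.Finite.of_finite_image (f := Subtype.val) (h.subset ?_)
      Subtype.val_injective.injOn
    rintro _ ⟨γ, hγ, rfl⟩
    exact ⟨γ.2, subset_tsupport _ hγ⟩)).of_exponent_ge zero_le⟩

@[simp] theorem restrict_apply (ξ : C_c(Arrows X, ℂ)) (x : X) (γ : Fibre x) :
    restrict ξ x γ = ξ γ := rfl

/-- The fibrewise inner product `x ↦ ∑_{γ ∈ 𝒢_x} conj (η γ) * ξ γ` of two continuous compactly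
supported functions lies in `C₀(𝒢⁽⁰⁾)`. -/
theorem exists_inner_restrict (η ξ : C_c(Arrows X, ℂ)) :
    ∃ f : C₀(X, ℂ), HasCompactSupport f ∧
      ∀ x, f x = inner ℂ (restrict η x) (restrict ξ x) := by
  have := t2Space_objects (X := X)
  let g : Arrows X → ℂ := fun γ => inner ℂ (η γ) (ξ γ)
  have hg : Continuous g := by fun_prop
  have hgc : HasCompactSupport g := ξ.hasCompactSupport.mono (fun γ h h0 => h (by simp [g, h0]))
  have hF := continuous_fibre_sum g hg hgc
  have hFc : HasCompactSupport (fun x : X => ∑' γ : Fibre x, g γ) :=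
    HasCompactSupport.intro (hgc.image isLocalHomeomorph_source.continuous)
      (fun x hx => tsum_fibre_eq_zero g x hx)
  exact ⟨⟨⟨_, hF⟩, hFc.is_zero_at_infty⟩, hFc, fun x =>
    (lp.inner_eq_tsum (restrict η x) (restrict ξ x)).symm⟩

theorem bddAbove_norm_restrict (ξ : C_c(Arrows X, ℂ)) :
    BddAbove (Set.range fun x : X => ‖restrict ξ x‖) := by
  obtain ⟨f, -, hf⟩ := exists_inner_restrict ξ ξ
  refine ⟨√‖f‖, ?_⟩
  rintro _ ⟨x, rfl⟩
  refine Real.le_sqrt_of_sq_le ?_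
  change ‖restrict ξ x‖ ^ 2 ≤ ‖f‖
  rw [← norm_inner_self, ← hf]
  exact f.toBCF.norm_coe_le_norm x

/-- The slicing map `C_c(𝒢) → ∏_x ℓ²(𝒢_x)`, `ξ ↦ (ξ|_{𝒢_x})_x`. -/
noncomputable def restrictFamily : C_c(Arrows X, ℂ) →ₗ[ℂ] ell2Family X where
  toFun ξ := ⟨fun x => restrict ξ x, memℓp_infty (bddAbove_norm_restrict ξ)⟩
  map_add' _ _ := rfl
  map_smul' _ _ := rfl

variable (X) in
/-- The Hilbert `C₀(𝒢⁽⁰⁾)`-module `L²(𝒢)`: the completion of `C_c(𝒢)` in the norm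
`‖ξ‖² = sup_x ∑_{γ ∈ 𝒢_x} |ξ γ|²`, realized as the closure of `C_c(𝒢)` in the Banach space
`∏_x ℓ²(𝒢_x)` (whose norm restricts to that norm on `C_c(𝒢)`). -/
noncomputable def L2 : Submodule ℂ (ell2Family X) :=
  (LinearMap.range (restrictFamily (X := X))).topologicalClosure

/-- The slicing map `φ_x : L²(𝒢) → ℓ²(𝒢_x)`, `ξ ↦ ξ|_{𝒢_x}`. -/
noncomputable def sliceVector (x : X) (ξ : L2 X) : ell2 x := (ξ : ell2Family X) x

theorem exists_inner (η ξ : L2 X) :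
    ∃ f : C₀(X, ℂ), ∀ x, f x = inner ℂ (sliceVector x η) (sliceVector x ξ) := by
  obtain ⟨ξ, hξ⟩ := ξ
  obtain ⟨η, hη⟩ := η
  refine exists_inner_of_mem_closure η _ ?_ ξ hξ
  rintro _ ⟨ξ', rfl⟩
  obtain ⟨f, hf⟩ := exists_inner_of_mem_closure (restrictFamily ξ')
    (LinearMap.range (restrictFamily (X := X)) : Set (ell2Family X))
    (by
      rintro _ ⟨η', rfl⟩
      obtain ⟨f, -, hf⟩ := exists_inner_restrict ξ' η'
      exact ⟨f, hf⟩) η hη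
  refine ⟨star f, fun x => ?_⟩
  have h : star (f x) = star (inner ℂ (restrictFamily ξ' x) (η x)) := by rw [hf]
  exact h.trans (inner_conj_symm _ _)

/-- The `C₀(𝒢⁽⁰⁾)`-valued inner product `⟨η, ξ⟩(x) = ∑_{γ ∈ 𝒢_x} conj (η γ) * ξ γ` on `L²(𝒢)`. -/
noncomputable def innerL2 (η ξ : L2 X) : C₀(X, ℂ) := (exists_inner η ξ).choose

theorem innerL2_apply (η ξ : L2 X) (x : X) :
    innerL2 η ξ x = inner ℂ (sliceVector x η) (sliceVector x ξ) :=
  (exists_inner η ξ).choose_spec x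

/-- Multiplication of a bounded family of vectors by a function in `C₀(𝒢⁽⁰⁾)`. -/
noncomputable def smulFamily (f : C₀(X, ℂ)) : ell2Family X →L[ℂ] ell2Family X :=
  LinearMap.mkContinuous
    { toFun := fun ξ => ⟨fun x => f x • ξ x, memℓp_infty ⟨‖f‖ * ‖ξ‖, by
        rintro _ ⟨x, rfl⟩
        simp only [norm_smul]
        exact mul_le_mul (f.toBCF.norm_coe_le_norm x) (lp.norm_apply_le_norm (by simp) ξ x)
          (norm_nonneg _) (norm_nonneg _)⟩⟩
      map_add' := fun ξ η => by ext x : 2; exact smul_add (f x) (ξ x) (η x)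
      map_smul' := fun c ξ => by ext x : 2; exact smul_comm (f x) c (ξ x) } ‖f‖ (fun ξ => by
        refine lp.norm_le_of_forall_le (by positivity) fun x => ?_
        change ‖f x • ξ x‖ ≤ _
        rw [norm_smul]
        exact mul_le_mul (f.toBCF.norm_coe_le_norm x) (lp.norm_apply_le_norm (by simp) ξ x)
          (norm_nonneg _) (norm_nonneg _))

theorem smulFamily_mem (f : C₀(X, ℂ)) (ξ : ell2Family X) (hξ : ξ ∈ L2 X) :
    smulFamily f ξ ∈ L2 X := by
  refine map_mem_closure (smulFamily f).continuous hξ ?_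
  rintro _ ⟨ξ', rfl⟩
  have hc := LocallyCompactGroupoid.continuous_source (X := X)
  refine ⟨⟨⟨fun γ => f (source γ) * ξ' γ, by fun_prop⟩,
    ξ'.hasCompactSupport.mul_left (f := fun γ => f (source γ))⟩, ?_⟩
  ext x γ
  change f (source (γ : Arrows X)) * ξ' γ = f x * ξ' γ
  rw [γ.2]

/-- The right action `(ξ f)(γ) = ξ(γ) f(s γ)` of `C₀(𝒢⁽⁰⁾)` on `L²(𝒢)`. -/
noncomputable instance : SMul C₀(X, ℂ) (L2 X) where
  smul f ξ := ⟨smulFamily f ξ, smulFamily_mem f ξ ξ.2⟩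

theorem sliceVector_smul (f : C₀(X, ℂ)) (ξ : L2 X) (x : X) :
    sliceVector x (f • ξ) = f x • sliceVector x ξ := rfl

open scoped ComplexOrder in
/-- The pointwise order of `C₀(Y)`, which is its order as a C⋆-algebra. -/
noncomputable instance c0PartialOrder {Y : Type*} [TopologicalSpace Y] : PartialOrder C₀(Y, ℂ) :=
  PartialOrder.lift (fun f => (f : Y → ℂ)) DFunLike.coe_injective

open scoped ComplexOrder in
/-- `L²(𝒢)` as a Hilbert C⋆-module over `C₀(𝒢⁽⁰⁾)`. -/
noncomputable instance : CStarModule C₀(X, ℂ) (L2 X) where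
  inner := innerL2
  inner_add_right {ξ η ζ} := by
    ext x
    simp only [ZeroAtInftyContinuousMap.add_apply, innerL2_apply]
    exact inner_add_right _ _ _
  inner_self_nonneg {ξ} := by
    intro x
    change 0 ≤ innerL2 ξ ξ x
    rw [innerL2_apply, inner_self_eq_norm_sq_to_K]
    norm_cast
    positivity
  inner_self {ξ} := by
    constructor
    · intro h
      ext x : 3
      have h1 := innerL2_apply ξ ξ x
      rw [h] at h1
      exact inner_self_eq_zero.1 h1.symm
    · rintro rfl
      ext x
      rw [innerL2_apply]
      exact inner_self_eq_zero.2 rfl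
  inner_op_smul_right {f ξ η} := by
    ext x
    simp only [ZeroAtInftyContinuousMap.mul_apply, innerL2_apply, sliceVector_smul,
      inner_smul_right]
  inner_smul_right_complex {c ξ η} := by
    ext x
    simp only [ZeroAtInftyContinuousMap.smul_apply, innerL2_apply]
    exact inner_smul_right _ _ _
  star_inner ξ η := by
    ext x
    change star (innerL2 ξ η x) = _
    simp only [innerL2_apply]
    exact inner_conj_symm _ _
  norm_eq_sqrt_norm_inner_self ξ := by
    have hx : ∀ x, ‖innerL2 ξ ξ x‖ = ‖sliceVector x ξ‖ ^ 2 := fun x => by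
      rw [innerL2_apply, norm_inner_self]
    apply le_antisymm
    · refine lp.norm_le_of_forall_le (Real.sqrt_nonneg _) fun x => Real.le_sqrt_of_sq_le ?_
      exact (hx x).symm.le.trans ((innerL2 ξ ξ).toBCF.norm_coe_le_norm x)
    · refine Real.sqrt_le_iff.2 ⟨norm_nonneg _, ?_⟩
      change ‖(innerL2 ξ ξ).toBCF‖ ≤ _
      refine (BoundedContinuousFunction.norm_le (by positivity)).2 fun x => ?_
      refine (hx x).le.trans ?_
      gcongr
      exact lp.norm_apply_le_norm (by simp) (ξ : ell2Family X) x

instance : CompleteSpace (L2 X) :=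
  (Submodule.isClosed_topologicalClosure _).completeSpace_coe

end Topology

/-- A map `T` on a Hilbert C⋆-module over `A` is adjointable if it has an adjoint with respect to
the `A`-valued inner product. -/
def IsAdjointable (A : Type*) {E : Type*} [Inner A E] (T : E → E) : Prop :=
  ∃ S : E → E, ∀ ξ η : E, inner A η (T ξ) = inner A (S η) ξ

section Operators

variable {X : Type u} [Groupoid.{v} X]

/-- The operator of multiplication by the characteristic function `χ_A` on `ℓ²(𝒢_x)`. -/
noncomputable def chi {x : X} (A : Set (Fibre x)) : ell2 x →L[ℂ] ell2 x :=
  LinearMap.mkContinuous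
    { toFun := fun ξ => ⟨A.indicator ξ, (lp.memℓp ξ).mono' fun γ => by
          by_cases h : γ ∈ A <;> simp [h]⟩
      map_add' := fun ξ η => by ext γ : 2; exact congrFun (A.indicator_add ξ η) γ
      map_smul' := fun c ξ => by
        ext γ : 2; exact congrFun (Set.indicator_const_smul A c ξ) γ } 1 (fun ξ => by
        rw [one_mul]
        refine lp.norm_mono (by simp) fun γ => ?_
        change ‖A.indicator ξ γ‖ ≤ _
        by_cases h : γ ∈ A <;> simp [h])

open scoped Classical in
/-- The canonical basis vector `δ_γ ∈ ℓ²(𝒢_x)`. -/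
noncomputable def delta {x : X} (γ : Fibre x) : ell2 x := lp.single 2 γ 1

variable (X) in
/-- The operator fibre space `E = ⨆_x B(ℓ²(𝒢_x))` (disjoint union). -/
structure OperatorFibreSpace where
  /-- the base point `x` -/
  base : X
  /-- the operator in the fibre over `x` -/
  op : ell2 base →L[ℂ] ell2 base

/-- The topology of the operator fibre space, generated by the sets of all `σ_x` having, for given
open `U, V ⊆ 𝒢` and `O ⊆ ℂ`, a matrix coefficient `⟨δ_γ'', σ_x δ_γ'⟩ ∈ O` with
`γ' ∈ U ∩ 𝒢_x` and `γ'' ∈ V ∩ 𝒢_x`. Its convergent nets are described in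
`OperatorFibreSpace.tendsto_nhds_iff`. -/
instance [TopologicalSpace (Arrows X)] : TopologicalSpace (OperatorFibreSpace X) :=
  TopologicalSpace.generateFrom
    {W | ∃ (U V : Set (Arrows X)) (O : Set ℂ), IsOpen U ∧ IsOpen V ∧ IsOpen O ∧
      W = {σ | ∃ γ' γ'' : Fibre σ.base, (γ' : Arrows X) ∈ U ∧ (γ'' : Arrows X) ∈ V ∧
        inner ℂ (delta γ'') (σ.op (delta γ')) ∈ O}}

variable [TopologicalSpace X] [TopologicalSpace (Arrows X)] [LocallyCompactEtaleGroupoid X]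

/-- A net `σ_i` converges to `σ` in the operator fibre space if and only if the base points `x_i`
converge to `x` and, whenever `γ'_i → γ'` and `γ''_i → γ''` in `𝒢` with `γ'_i, γ''_i ∈ 𝒢_{x_i}`,
the matrix coefficients `⟨δ_{γ''_i}, σ_i δ_{γ'_i}⟩` converge to `⟨δ_γ'', σ δ_γ'⟩`. -/
theorem OperatorFibreSpace.tendsto_nhds_iff {ι : Type*} (l : Filter ι)
    (f : ι → OperatorFibreSpace X) (σ : OperatorFibreSpace X) :
    Tendsto f l (𝓝 σ) ↔ Tendsto (fun i => (f i).base) l (𝓝 σ.base) ∧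
      ∀ (a b : ∀ i, Fibre (f i).base) (γ' γ'' : Fibre σ.base),
        Tendsto (fun i => (a i : Arrows X)) l (𝓝 γ') →
        Tendsto (fun i => (b i : Arrows X)) l (𝓝 γ'') →
        Tendsto (fun i => inner ℂ (delta (b i)) ((f i).op (delta (a i)))) l
          (𝓝 (inner ℂ (delta γ'') (σ.op (delta γ')))) := by
  have hs := isLocalHomeomorph_source (X := X)
  constructor
  · intro h
    have hgen : ∀ (U V : Set (Arrows X)) (O : Set ℂ), IsOpen U → IsOpen V → IsOpen O →
        (∃ γ' γ'' : Fibre σ.base, (γ' : Arrows X) ∈ U ∧ (γ'' : Arrows X) ∈ V ∧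
          inner ℂ (delta γ'') (σ.op (delta γ')) ∈ O) →
        ∀ᶠ i in l, ∃ γ' γ'' : Fibre (f i).base, (γ' : Arrows X) ∈ U ∧ (γ'' : Arrows X) ∈ V ∧
          inner ℂ (delta γ'') ((f i).op (delta γ')) ∈ O := by
      intro U V O hU hV hO hσ
      exact h.eventually_mem (IsOpen.mem_nhds
        (TopologicalSpace.isOpen_generateFrom_of_mem ⟨U, V, O, hU, hV, hO, rfl⟩) hσ)
    refine ⟨?_, ?_⟩
    · rw [tendsto_nhds]
      intro W hW hσ
      have := hgen (source ⁻¹' W) univ univ (hW.preimage hs.continuous) isOpen_univ isOpen_univ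
        ⟨⟨unit σ.base, rfl⟩, ⟨unit σ.base, rfl⟩, hσ, mem_univ _, mem_univ _⟩
      filter_upwards [this] with i hi
      obtain ⟨γ', -, h1, -⟩ := hi
      have h2 : source (γ' : Arrows X) ∈ W := h1
      rwa [γ'.2] at h2
    · intro a b γ' γ'' ha hb
      rw [tendsto_nhds]
      intro O hO hmem
      obtain ⟨U, hUo, hU, hUi⟩ := hs.isLocallyInjective (γ' : Arrows X)
      obtain ⟨V, hVo, hV, hVi⟩ := hs.isLocallyInjective (γ'' : Arrows X)
      filter_upwards [hgen U V O hUo hVo hO ⟨γ', γ'', hU, hV, hmem⟩,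
        ha.eventually_mem (hUo.mem_nhds hU), hb.eventually_mem (hVo.mem_nhds hV)] with i hi hai hbi
      obtain ⟨c, d, hc, hd, hcd⟩ := hi
      have h1 : c = a i := Subtype.ext (hUi hc hai (c.2.trans (a i).2.symm))
      have h2 : d = b i := Subtype.ext (hVi hd hbi (d.2.trans (b i).2.symm))
      rw [h1, h2] at hcd
      exact hcd
  · rintro ⟨hbase, hcoef⟩
    -- lift the base points to a given arrow in the limit fibre
    have hlift : ∀ γ : Fibre σ.base, ∃ a : ∀ i, Fibre (f i).base,
        Tendsto (fun i => (a i : Arrows X)) l (𝓝 γ) := by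
      classical
      intro γ
      let e := hs.localInverseAt (γ : Arrows X)
      have h1 : σ.base ∈ e.source := by
        have := hs.apply_self_mem_localInverseAt_source (x := (γ : Arrows X))
        rwa [γ.2] at this
      have h2 : e σ.base = γ := by
        have := hs.localInverseAt_apply_self (x := (γ : Arrows X))
        rwa [γ.2] at this
      refine ⟨fun i => if h : (f i).base ∈ e.source then
        ⟨e (f i).base, hs.apply_localInverseAt_of_mem h⟩ else ⟨unit (f i).base, rfl⟩, ?_⟩
      have h3 : Tendsto (fun i => e (f i).base) l (𝓝 γ) := by
        have := (e.continuousAt h1).tendsto.comp hbase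
        rwa [h2] at this
      refine h3.congr' ?_
      filter_upwards [hbase.eventually_mem (e.open_source.mem_nhds h1)] with i hi
      simp [hi]
    rw [TopologicalSpace.tendsto_nhds_generateFrom_iff]
    rintro _ ⟨U, V, O, hU, hV, hO, rfl⟩ ⟨γ', γ'', h1, h2, h3⟩
    obtain ⟨a, ha⟩ := hlift γ'
    obtain ⟨b, hb⟩ := hlift γ''
    filter_upwards [ha.eventually_mem (hU.mem_nhds h1), hb.eventually_mem (hV.mem_nhds h2),
      (hcoef a b γ' γ'' ha hb).eventually_mem (hO.mem_nhds h3)] with i h1 h2 h3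
    exact ⟨a i, b i, h1, h2, h3⟩

/-- The family `(T_x)_x` is a continuous section of the operator fibre space. -/
def IsContinuousSection (T : ∀ x : X, ell2 x →L[ℂ] ell2 x) : Prop :=
  Continuous fun x => (⟨x, T x⟩ : OperatorFibreSpace X)

/-- The family `(T_x)_x` is vector-wise uniformly quasi-local. -/
def IsVectorwiseUniformlyQuasiLocal (T : ∀ x : X, ell2 x →L[ℂ] ell2 x) : Prop :=
  ∀ ε > (0 : ℝ), ∀ ξ : C_c(Arrows X, ℂ), ∃ K : Set (Arrows X), IsCompact K ∧
    ∀ (x : X) (A B : Set (Fibre x)),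
      (Subtype.val '' A) ∩ setProduct K (Subtype.val '' B) = ∅ →
        ‖(chi A ∘L T x ∘L chi B) (restrict ξ x)‖ < ε

/-- The family `(T_x)_x` is the image `Φ(S) = (Φ_x(S))_x` of `S` under the slicing map: for each `x`,
`T_x` is the slice of `S` at `x`, the (unique) operator with `T_x(ξ|_{𝒢_x}) = S(ξ)|_{𝒢_x}` for all
`ξ ∈ L²(𝒢)`. -/
def IsSliceFamily (S : L2 X → L2 X) (T : ∀ x : X, ell2 x →L[ℂ] ell2 x) : Prop :=
  ∀ (x : X) (ξ : L2 X), T x (sliceVector x ξ) = sliceVector x (S ξ)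

end Operators

end EtaleGroupoid

open EtaleGroupoid
open scoped ZeroAtInfty

/-! A bounded family of vectors lies in `L2 X` as soon as it is continuous on 𝒢 and, uniformly over
the fibres, small in ℓ² off compact sets (`mem_L2_of_continuous`). Conversely, elements of `L2 X`
are continuous (`continuous_toFunction`) and uniformly approximable by C_c functions
(`exists_restrict_approx`). The two conditions on T match these two properties of Tξ for ξ in
C_c(𝒢).

A function supported where the source map is injective restricts to each fibre as a multiple of at
most one basis vector, and such functions span C_c(𝒢) (`compactlySupported_induction`). Continuity
of matrix coefficients therefore makes Tξ continuous. Quasi-locality, with A the complement of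
K·supp ξ and B = supp ξ, makes Tξ small off that compact product. Hence T preserves `L2 X`
(`familyMap_mem_L2`); so does the adjoint family, and the two fibrewise actions are adjoint to each
other.

In the other direction, a matrix coefficient of a slice is locally a value of the continuous
function Sξ. If η in C_c(𝒢) approximates Sξ, then supp η·(supp ξ)⁻¹ witnesses quasi-locality for ξ
with source-injective support. The adjoint of S has the adjoint operators as slices
(`IsSliceFamily.adjoint`), so the same argument covers them. -/

namespace EtaleGroupoid

open CategoryTheory Topology Set Filter
open scoped ZeroAtInfty CompactlySupported ENNReal

/-! ### Vectors and arrows in a single source fibre -/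

section Fibrewise

variable {X : Type u} [Groupoid.{v} X] {x : X}

theorem chi_apply (A : Set (Fibre x)) (v : ell2 x) (γ : Fibre x) :
    chi A v γ = A.indicator v γ := rfl

theorem norm_chi_apply_le (A : Set (Fibre x)) (v : ell2 x) : ‖chi A v‖ ≤ ‖v‖ := by
  refine lp.norm_mono (by simp) fun γ => ?_
  rw [chi_apply]
  by_cases h : γ ∈ A <;> simp [h]

theorem chi_eq_zero {A : Set (Fibre x)} {v : ell2 x} (h : ∀ γ ∈ A, v γ = 0) : chi A v = 0 := by
  ext γ
  rw [chi_apply]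
  by_cases hγ : γ ∈ A
  · simp [hγ, h γ hγ]
  · simp [hγ]

theorem chi_eq_self {A : Set (Fibre x)} {v : ell2 x} (h : ∀ γ, v γ ≠ 0 → γ ∈ A) :
    chi A v = v := by
  ext γ
  rw [chi_apply]
  by_cases hγ : γ ∈ A
  · simp [hγ]
  · rw [indicator_of_notMem hγ]
    by_contra h0
    exact hγ (h γ (Ne.symm h0))

theorem inner_delta_left (γ : Fibre x) (v : ell2 x) : inner ℂ (delta γ) v = v γ := by
  classical
  rw [delta, lp.inner_single_left]
  simp

theorem delta_apply_self (γ : Fibre x) : (delta γ : ell2 x) γ = 1 := by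
  classical
  simp [delta]

theorem delta_apply_ne {γ γ' : Fibre x} (h : γ' ≠ γ) : (delta γ : ell2 x) γ' = 0 := by
  classical
  simp [delta, h]

theorem ext_inner_delta {v w : ell2 x} (h : ∀ γ : Fibre x, inner ℂ v (delta γ) = inner ℂ w (delta γ)) :
    v = w := by
  ext γ
  rw [← inner_delta_left, ← inner_delta_left, ← inner_conj_symm, h, inner_conj_symm]

theorem setProduct_mono_left {K L : Set (Arrows X)} (h : K ⊆ L) (B : Set (Arrows X)) :
    setProduct K B ⊆ setProduct L B := by
  rintro _ ⟨γ₁, h₁, γ₂, h₂, hc, rfl⟩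
  exact ⟨γ₁, h h₁, γ₂, h₂, hc, rfl⟩

theorem setProduct_mono_right (K : Set (Arrows X)) {A B : Set (Arrows X)} (h : A ⊆ B) :
    setProduct K A ⊆ setProduct K B := by
  rintro _ ⟨γ₁, h₁, γ₂, h₂, hc, rfl⟩
  exact ⟨γ₁, h₁, γ₂, h h₂, hc, rfl⟩

/-- `δ = (δ γ⁻¹) γ` whenever `s δ = s γ`. -/
theorem mem_setProduct_of_source_eq {K L B : Set (Arrows X)} {δ γ : Arrows X} (hδ : δ ∈ K)
    (hγ : γ ∈ L) (hB : γ ∈ B) (h : source δ = source γ) :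
    δ ∈ setProduct (setProduct K (inverse '' L)) B := by
  obtain ⟨a, b, f⟩ := δ
  obtain ⟨c, d, g⟩ := γ
  obtain rfl : a = c := h
  refine ⟨product ⟨a, b, f⟩ (inverse ⟨a, d, g⟩) rfl,
    ⟨_, hδ, _, mem_image_of_mem _ hγ, rfl, rfl⟩, _, hB, rfl, ?_⟩
  -- Both `eqToHom` factors are along reflexive equalities, so they are definitionally identities.
  change (⟨a, b, f⟩ : Arrows X) = ⟨a, b, g ≫ 𝟙 d ≫ Groupoid.inv g ≫ 𝟙 a ≫ f⟩
  rw [Category.id_comp, Category.id_comp, ← Category.assoc, Groupoid.comp_inv, Category.id_comp]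

/-- The value of a family of vectors, seen as a function on `𝒢`. -/
noncomputable def toFunction (F : ell2Family X) (γ : Arrows X) : ℂ := F (source γ) ⟨γ, rfl⟩

theorem toFunction_eq (F : ell2Family X) {x : X} (γ : Fibre x) : toFunction F γ = F x γ := by
  obtain ⟨γ, rfl⟩ := γ
  rfl

/-- Convergence of families thus implies uniform convergence on 𝒢, which is how continuity passes to
the closure of C_c(𝒢). -/
theorem norm_toFunction_le (F : ell2Family X) (γ : Arrows X) : ‖toFunction F γ‖ ≤ ‖F‖ :=
  (lp.norm_apply_le_norm (by simp) _ _).trans (lp.norm_apply_le_norm (by simp) F _)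

end Fibrewise

/-- A uniformly bounded family of operators, acting on `∏_x ℓ²(𝒢_x)`. -/
noncomputable def familyMap {X : Type u} [Groupoid.{v} X] (T : ∀ x : X, ell2 x →L[ℂ] ell2 x)
    {M : ℝ} (hM : 0 ≤ M) (hT : ∀ x, ‖T x‖ ≤ M) : ell2Family X →L[ℂ] ell2Family X :=
  lp.mapCLM ∞ T hM hT

theorem familyMap_apply {X : Type u} [Groupoid.{v} X] (T : ∀ x : X, ell2 x →L[ℂ] ell2 x)
    {M : ℝ} (hM : 0 ≤ M) (hT : ∀ x, ‖T x‖ ≤ M) (ξ : ell2Family X) (x : X) :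
    familyMap T hM hT ξ x = T x (ξ x) := rfl

/-! ### Compact sets and source-injective supports -/

section Topology

variable {X : Type u} [TopologicalSpace X] [Groupoid.{v} X] [TopologicalSpace (Arrows X)]
  [LocallyCompactEtaleGroupoid X]

/-- The unit space is Hausdorff, so composable pairs form a closed set; its part in K × L is
compact, with image KL under the continuous product. -/
theorem isCompact_setProduct {K L : Set (Arrows X)} (hK : IsCompact K) (hL : IsCompact L) :
    IsCompact (setProduct K L) := by
  have := t2Space_objects (X := X)
  have hs := LocallyCompactGroupoid.continuous_source (X := X)
  have hr := LocallyCompactGroupoid.continuous_range (X := X)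
  have hcl : IsClosed {p : Arrows X × Arrows X | source p.1 = range p.2} :=
    isClosed_eq (hs.comp continuous_fst) (hr.comp continuous_snd)
  have h := (hcl.isClosedEmbedding_subtypeVal.isCompact_preimage (hK.prod hL)).image
    (LocallyCompactGroupoid.continuous_product (X := X))
  convert h using 1
  ext γ
  constructor
  · rintro ⟨γ₁, h₁, γ₂, h₂, hc, rfl⟩
    exact ⟨⟨(γ₁, γ₂), hc⟩, ⟨h₁, h₂⟩, rfl⟩
  · rintro ⟨⟨⟨γ₁, γ₂⟩, hc⟩, ⟨h₁, h₂⟩, rfl⟩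
    exact ⟨γ₁, h₁, γ₂, h₂, hc, rfl⟩

/-- The last bound controls the error when a function is truncated by multiplication with h. -/
theorem exists_bump {K U : Set (Arrows X)} (hK : IsCompact K) (hU : IsOpen U) (hKU : K ⊆ U) :
    ∃ h : C_c(Arrows X, ℂ), (∀ γ ∈ K, h γ = 1) ∧ tsupport h ⊆ U ∧ ∀ γ, ‖1 - h γ‖ ≤ 1 := by
  have := LocallyCompactGroupoid.t2Space (X := X)
  have := LocallyCompactGroupoid.locallyCompactSpace (X := X)
  obtain ⟨f, hf1, hfc, hfU, hf⟩ := exists_continuousMap_one_of_isCompact_subset_isOpen hK hU hKU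
  have hsub : tsupport (fun γ => (f γ : ℂ)) ⊆ tsupport f :=
    closure_mono fun γ hγ h0 => hγ (by simp only [h0, Complex.ofReal_zero])
  refine ⟨⟨⟨fun γ => (f γ : ℂ), by fun_prop⟩,
    hfc.of_isClosed_subset (isClosed_tsupport _) hsub⟩, ?_, hsub.trans hfU, ?_⟩
  · intro γ hγ
    change (f γ : ℂ) = 1
    rw [hf1 hγ]
    simp
  · intro γ
    change ‖1 - (f γ : ℂ)‖ ≤ 1
    rw [← Complex.ofReal_one, ← Complex.ofReal_sub, Complex.norm_real, Real.norm_eq_abs, abs_le]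
    constructor <;> linarith [(hf γ).1, (hf γ).2]

/-- Every function in `C_c(𝒢)` is a finite sum of functions supported in open sets on which the
source map is injective. -/
theorem compactlySupported_induction {p : C_c(Arrows X, ℂ) → Prop} (zero : p 0)
    (add : ∀ ξ η, p ξ → p η → p (ξ + η))
    (basic : ∀ (ξ : C_c(Arrows X, ℂ)) (U : Set (Arrows X)), IsOpen U → InjOn source U →
      tsupport ξ ⊆ U → p ξ) (ξ : C_c(Arrows X, ℂ)) : p ξ := by
  have := LocallyCompactGroupoid.t2Space (X := X)
  have := LocallyCompactGroupoid.locallyCompactSpace (X := X)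
  have hs := isLocalHomeomorph_source (X := X)
  choose U hUo hmem hinj using fun γ : Arrows X => hs.isLocallyInjective γ
  have hξ : IsCompact (tsupport ξ) := ξ.hasCompactSupport
  obtain ⟨t, -, ht⟩ := hξ.elim_nhds_subcover U fun γ _ => (hUo γ).mem_nhds (hmem γ)
  let e := t.equivFin.symm
  have hcov : tsupport ξ ⊆ ⋃ i, U (e i) := fun γ hγ => by
    obtain ⟨δ, hδ, h⟩ := mem_iUnion₂.1 (ht hγ)
    exact mem_iUnion.2 ⟨e.symm ⟨δ, hδ⟩, by simpa using h⟩
  obtain ⟨f, hfU, hf1, -, -⟩ :=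
    exists_continuous_sum_one_of_isOpen_isCompact (fun i => hUo (e i)) hξ hcov
  let ξi : Fin t.card → C_c(Arrows X, ℂ) := fun i =>
    ⟨⟨fun γ => (f i γ : ℂ) * ξ γ, by fun_prop⟩,
      ξ.hasCompactSupport.mul_left (f := fun γ => (f i γ : ℂ))⟩
  have hsum : ξ = ∑ i, ξi i := by
    ext γ
    rw [CompactlySupportedContinuousMap.sum_apply]
    change ξ γ = ∑ i, (f i γ : ℂ) * ξ γ
    rw [← Finset.sum_mul]
    -- The partition functions sum to 1 only on supp ξ; elsewhere both sides vanish.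
    by_cases hγ : γ ∈ tsupport ξ
    · have h1 := hf1 hγ
      simp only [Finset.sum_apply, Pi.one_apply] at h1
      rw [← Complex.ofReal_sum, h1]
      simp
    · simp [image_eq_zero_of_notMem_tsupport hγ]
  rw [hsum]
  refine Finset.sum_induction _ p add zero fun i _ => basic _ _ (hUo (e i)) (hinj (e i)) ?_
  have hsub : tsupport (ξi i) ⊆ tsupport (f i) := closure_mono fun γ hγ h0 => hγ ?_
  · exact hsub.trans (hfU i)
  change (f i γ : ℂ) * ξ γ = 0
  rw [h0, Complex.ofReal_zero, zero_mul]

/-- Injectivity of the source on U leaves γ as the only arrow of its fibre in U. -/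
theorem restrict_eq_smul_delta {ξ : C_c(Arrows X, ℂ)} {U : Set (Arrows X)} (hU : InjOn source U)
    (hξ : tsupport ξ ⊆ U) {x : X} (γ : Fibre x) (hγ : (γ : Arrows X) ∈ U) :
    restrict ξ x = ξ γ • delta γ := by
  ext δ
  rw [restrict_apply, lp.coeFn_smul, Pi.smul_apply, smul_eq_mul]
  by_cases h : δ = γ
  · rw [h, delta_apply_self, mul_one]
  · rw [delta_apply_ne h, mul_zero]
    by_contra h0
    exact h (Subtype.ext (hU (hξ (subset_tsupport _ h0)) hγ (δ.2.trans γ.2.symm)))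

/-- Near a given arrow, the canonical basis vectors are the restrictions of one function. -/
theorem exists_restrict_eq_delta (γ : Arrows X) :
    ∃ ξ : C_c(Arrows X, ℂ), ∀ᶠ δ in 𝓝 γ, ∀ x (h : source δ = x),
      restrict ξ x = delta ⟨δ, h⟩ := by
  have := LocallyCompactGroupoid.locallyCompactSpace (X := X)
  obtain ⟨U, hUo, hU, hi⟩ := (isLocalHomeomorph_source (X := X)).isLocallyInjective γ
  -- The bump function equals 1 on a whole compact neighbourhood, so the coefficient of the basis
  -- vector is exactly 1 there.
  obtain ⟨K, hK, hKU, hKc⟩ := local_compact_nhds (hUo.mem_nhds hU)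
  obtain ⟨ξ, h1, hξ, -⟩ := exists_bump hKc hUo hKU
  refine ⟨ξ, ?_⟩
  filter_upwards [hK] with δ hδ x h
  rw [restrict_eq_smul_delta hi hξ ⟨δ, h⟩ (hKU hδ), h1 δ hδ, one_smul]

/-! ### Membership in L²(𝒢) -/

/-- The elements of `L²(𝒢)` are continuous functions on `𝒢`. -/
theorem continuous_toFunction {F : ell2Family X} (hF : F ∈ L2 X) : Continuous (toFunction F) := by
  refine continuous_of_uniform_approx_of_continuous fun u hu => ?_
  obtain ⟨ε, hε, hεu⟩ := Metric.mem_uniformity_dist.1 hu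
  obtain ⟨_, ⟨ξ, rfl⟩, hd⟩ := Metric.mem_closure_iff.1 hF ε hε
  refine ⟨ξ, map_continuous ξ, fun γ => hεu ?_⟩
  rw [dist_eq_norm] at hd ⊢
  exact (norm_toFunction_le (F - restrictFamily ξ) γ).trans_lt hd

theorem exists_restrict_approx {F : ell2Family X} (hF : F ∈ L2 X) {ε : ℝ} (hε : 0 < ε) :
    ∃ ξ : C_c(Arrows X, ℂ), ∀ x, ‖F x - restrict ξ x‖ < ε := by
  obtain ⟨_, ⟨ξ, rfl⟩, hd⟩ := Metric.mem_closure_iff.1 hF ε hε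
  rw [dist_eq_norm] at hd
  exact ⟨ξ, fun x => (lp.norm_apply_le_norm (by simp) (F - restrictFamily ξ) x).trans_lt hd⟩

/-- A bounded family of vectors which is continuous on `𝒢`, and uniformly small off compact sets,
lies in `L²(𝒢)`. -/
theorem mem_L2_of_continuous {F : ell2Family X} (hc : Continuous (toFunction F))
    (h : ∀ ε > 0, ∃ K : Set (Arrows X), IsCompact K ∧
      ∀ x, ‖chi {γ : Fibre x | (γ : Arrows X) ∉ K} (F x)‖ ≤ ε) : F ∈ L2 X := by
  refine Metric.mem_closure_iff.2 fun ε hε => ?_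
  obtain ⟨K, hK, hKF⟩ := h (ε / 2) (half_pos hε)
  obtain ⟨b, hb, -, hb1⟩ := exists_bump hK isOpen_univ (subset_univ K)
  -- The truncation F·b has no error on K and error at most |F| off K. Starting from ε/2 turns the
  -- non-strict bound on the supremum into a strict one.
  refine ⟨_, ⟨⟨⟨fun γ => toFunction F γ * b γ, by fun_prop⟩,
    b.hasCompactSupport.mul_left (f := toFunction F)⟩, rfl⟩, ?_⟩
  rw [dist_eq_norm]
  refine lt_of_le_of_lt (lp.norm_le_of_forall_le (half_pos hε).le fun x => ?_) (half_lt_self hε)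
  refine le_trans (lp.norm_mono (by simp) fun γ => ?_) (hKF x)
  change ‖F x γ - toFunction F γ * b γ‖ ≤ _
  rw [toFunction_eq, chi_apply]
  by_cases hγ : (γ : Arrows X) ∈ K
  · simp [hb γ hγ]
  · rw [indicator_of_mem (show γ ∈ {γ : Fibre x | (γ : Arrows X) ∉ K} from hγ), ← mul_one_sub,
      norm_mul]
    exact mul_le_of_le_one_right (norm_nonneg _) (hb1 γ)

/-! ### Continuous quasi-local families preserve L²(𝒢) -/

theorem restrictFamily_mem (ξ : C_c(Arrows X, ℂ)) : restrictFamily ξ ∈ L2 X :=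
  subset_closure ⟨ξ, rfl⟩

/-- The source image of the compact support is closed in the Hausdorff unit space, so its complement
is a neighbourhood of x. -/
theorem eventually_restrict_eq_zero (ξ : C_c(Arrows X, ℂ)) {x : X}
    (hx : x ∉ source '' tsupport ξ) : ∀ᶠ y in 𝓝 x, restrict ξ y = 0 := by
  have := t2Space_objects (X := X)
  have hcl : IsClosed (source '' tsupport ξ) :=
    (IsCompact.image ξ.hasCompactSupport isLocalHomeomorph_source.continuous).isClosed
  filter_upwards [hcl.isOpen_compl.mem_nhds hx] with y hy
  ext γ
  by_contra h0
  exact hy ⟨γ, subset_tsupport _ h0, γ.2⟩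

/-- A net of units converging to `s γ` lifts to a net of arrows converging to `γ`. -/
theorem exists_lift {ι : Type*} {l : Filter ι} {f : ι → X} (γ : Arrows X)
    (hf : Tendsto f l (𝓝 (source γ))) :
    ∃ a : ∀ i, Fibre (f i), Tendsto (fun i => (a i : Arrows X)) l (𝓝 γ) := by
  classical
  have hs := isLocalHomeomorph_source (X := X)
  let e := hs.localInverseAt γ
  have h1 : source γ ∈ e.source := hs.apply_self_mem_localInverseAt_source
  have h2 : e (source γ) = γ := hs.localInverseAt_apply_self
  refine ⟨fun i => if h : f i ∈ e.source then
    ⟨e (f i), hs.apply_localInverseAt_of_mem h⟩ else ⟨unit (f i), rfl⟩, ?_⟩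
  have h3 : Tendsto (fun i => e (f i)) l (𝓝 γ) := by
    have := (e.continuousAt h1).tendsto.comp hf
    rwa [h2] at this
  refine h3.congr' ?_
  filter_upwards [hf.eventually_mem (e.open_source.mem_nhds h1)] with i hi
  simp [hi]

/-- Passing to adjoints swaps the two arrows of a matrix coefficient and conjugates it; the
convergence criterion is symmetric in the arrows. -/
theorem isContinuousSection_adjoint {T : ∀ x : X, ell2 x →L[ℂ] ell2 x}
    (hT : IsContinuousSection T) :
    IsContinuousSection fun x => ContinuousLinearMap.adjoint (T x) := by
  refine continuous_iff_continuousAt.2 fun x => ?_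
  refine (OperatorFibreSpace.tendsto_nhds_iff _ _ _).2 ⟨tendsto_id, fun a b γ' γ'' ha hb => ?_⟩
  have h := ((OperatorFibreSpace.tendsto_nhds_iff _ _ _).1 (hT.tendsto x)).2 b a γ'' γ' hb ha
  have h' := (Complex.continuous_conj.tendsto _).comp h
  simp only [ContinuousLinearMap.adjoint_inner_right]
  simpa only [Function.comp_def, inner_conj_symm] using h'

/-- A continuous section maps functions in `C_c(𝒢)` to continuous functions on `𝒢`. -/
theorem IsContinuousSection.continuous_apply_restrict {T : ∀ x : X, ell2 x →L[ℂ] ell2 x}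
    (hT : IsContinuousSection T) (ξ : C_c(Arrows X, ℂ)) :
    Continuous fun γ : Arrows X => T (source γ) (restrict ξ (source γ)) ⟨γ, rfl⟩ := by
  have hs := (isLocalHomeomorph_source (X := X)).continuous
  induction ξ using compactlySupported_induction with
  | zero =>
    have h (γ : Arrows X) : T (source γ) (restrict 0 (source γ)) ⟨γ, rfl⟩ = 0 := by
      rw [show restrict (0 : C_c(Arrows X, ℂ)) (source γ) = 0 from rfl, map_zero]
      rfl
    simp only [h]
    exact continuous_const
  | add ξ η h₁ h₂ =>
    refine (h₁.add h₂).congr fun γ => ?_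
    rw [show restrict (ξ + η) (source γ) = restrict ξ (source γ) + restrict η (source γ) from rfl,
      map_add]
    rfl
  | basic ξ U hUo hU hξ =>
    refine continuous_iff_continuousAt.2 fun γ => ?_
    by_cases hγ : source γ ∈ source '' tsupport ξ
    · obtain ⟨γ', hγ', he⟩ := hγ
      have hlim : Tendsto source (𝓝 γ) (𝓝 (source γ')) := he ▸ hs.tendsto γ
      -- As δ → γ, the lift a δ in the fibre of δ tends to γ'. Once a δ lies in U, the value of Tξ
      -- at δ is ξ(a δ) times the coefficient ⟨δ_δ, T δ_{a δ}⟩, and both factors converge.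
      obtain ⟨a, ha⟩ := exists_lift γ' hlim
      have h := ((OperatorFibreSpace.tendsto_nhds_iff _ _ _).1
        ((hT.tendsto (source γ)).comp (hs.tendsto γ))).2 a (fun δ => ⟨δ, rfl⟩) ⟨γ', he⟩ ⟨γ, rfl⟩
          ha tendsto_id
      have h' := (((map_continuous ξ).tendsto γ').comp ha).mul h
      simp only [ContinuousAt]
      have key : ∀ δ, (a δ : Arrows X) ∈ U →
          ξ (a δ) * inner ℂ (delta ⟨δ, rfl⟩) (T (source δ) (delta (a δ))) =
            T (source δ) (restrict ξ (source δ)) ⟨δ, rfl⟩ := fun δ hδ => by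
        rw [restrict_eq_smul_delta hU hξ (a δ) hδ, map_smul, inner_delta_left]
        rfl
      have key' : ξ γ' * inner ℂ (delta ⟨γ, rfl⟩) (T (source γ) (delta ⟨γ', he⟩)) =
            T (source γ) (restrict ξ (source γ)) ⟨γ, rfl⟩ := by
        rw [restrict_eq_smul_delta hU hξ ⟨γ', he⟩ (hξ hγ'), map_smul, inner_delta_left]
        rfl
      rw [← key']
      refine h'.congr' ?_
      filter_upwards [ha.eventually_mem (hUo.mem_nhds (hξ hγ'))] with δ hδ
      exact key δ hδ
    · have h := (hs.tendsto γ).eventually (eventually_restrict_eq_zero ξ hγ)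
      refine continuousAt_const.congr (f := fun _ => (0 : ℂ)) ?_
      filter_upwards [h] with δ hδ
      rw [hδ, map_zero]
      rfl

/-- Continuity and vector-wise uniform quasi-locality imply invariance of `L²(𝒢)`. -/
theorem familyMap_mem_L2 {T : ∀ x : X, ell2 x →L[ℂ] ell2 x} {M : ℝ} (hM : 0 ≤ M)
    (hTM : ∀ x, ‖T x‖ ≤ M) (hT : IsContinuousSection T) (hq : IsVectorwiseUniformlyQuasiLocal T)
    {F : ell2Family X} (hF : F ∈ L2 X) : familyMap T hM hTM F ∈ L2 X := by
  have hcl : IsClosed (L2 X : Set (ell2Family X)) := Submodule.isClosed_topologicalClosure _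
  -- By boundedness of the family and closedness of `L2 X`, it suffices to treat C_c functions.
  refine hcl.closure_subset (map_mem_closure (familyMap T hM hTM).continuous hF ?_)
  rintro _ ⟨ξ, rfl⟩
  refine mem_L2_of_continuous (F := familyMap T hM hTM (restrictFamily ξ))
    (hT.continuous_apply_restrict ξ) fun ε hε => ?_
  obtain ⟨K, hK, hKε⟩ := hq ε hε ξ
  refine ⟨setProduct K (tsupport ξ), isCompact_setProduct hK ξ.hasCompactSupport, fun x => ?_⟩
  let B : Set (Fibre x) := {γ | (γ : Arrows X) ∈ tsupport ξ}
  have h := hKε x {γ : Fibre x | (γ : Arrows X) ∉ setProduct K (tsupport ξ)} B (by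
    rw [← disjoint_iff_inter_eq_empty, Set.disjoint_left]
    rintro _ ⟨γ, hγ, rfl⟩ h
    exact hγ (setProduct_mono_right K (image_subset_iff.2 fun _ h => h) h))
  have hB : chi B (restrict ξ x) = restrict ξ x := chi_eq_self fun γ hγ => subset_tsupport _ hγ
  rw [ContinuousLinearMap.comp_apply, ContinuousLinearMap.comp_apply, hB] at h
  exact h.le

/-! ### Slices of maps on L²(𝒢) -/

/-- The family of slices of a map on `L²(𝒢)` is a continuous section. -/
theorem IsSliceFamily.isContinuousSection {S : L2 X → L2 X} {T : ∀ x : X, ell2 x →L[ℂ] ell2 x}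
    (h : IsSliceFamily S T) : IsContinuousSection T := by
  refine continuous_iff_continuousAt.2 fun x => ?_
  refine (OperatorFibreSpace.tendsto_nhds_iff _ _ _).2 ⟨tendsto_id, fun a b γ' γ'' ha hb => ?_⟩
  -- A single ξ represents δ_α for all arrows α near γ', so the coefficient ⟨δ_β, T δ_α⟩ is the
  -- value at β of the continuous function Sξ.
  obtain ⟨ξ, hξ⟩ := exists_restrict_eq_delta (γ' : Arrows X)
  let ζ : L2 X := ⟨restrictFamily ξ, restrictFamily_mem ξ⟩
  have key : ∀ (y : X) (α β : Fibre y), restrict ξ y = delta α →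
      toFunction (S ζ : ell2Family X) (β : Arrows X) = inner ℂ (delta β) (T y (delta α)) := by
    intro y α β hα
    have h1 : T y (restrict ξ y) = sliceVector y (S ζ) := h y ζ
    rw [inner_delta_left, ← hα, h1]
    exact toFunction_eq (S ζ : ell2Family X) β
  have hlim := ((continuous_toFunction (S ζ).2).tendsto _).comp hb
  simp only
  rw [← key x γ' γ'' (hξ.self_of_nhds x γ'.2)]
  refine hlim.congr' ?_
  filter_upwards [ha.eventually hξ] with y hy
  exact key y (a y) (b y) (hy y (a y).2)

/-- The family of slices of a map on `L²(𝒢)` is vector-wise uniformly quasi-local. -/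
theorem IsSliceFamily.isVectorwiseUniformlyQuasiLocal {S : L2 X → L2 X}
    {T : ∀ x : X, ell2 x →L[ℂ] ell2 x} (h : IsSliceFamily S T) :
    IsVectorwiseUniformlyQuasiLocal T := by
  intro ε hε ξ
  induction ξ using compactlySupported_induction generalizing ε with
  | zero =>
    refine ⟨∅, isCompact_empty, fun x A B _ => ?_⟩
    rwa [show restrict (0 : C_c(Arrows X, ℂ)) x = 0 from rfl, map_zero, norm_zero]
  | add ξ η h₁ h₂ =>
    obtain ⟨K, hK, hKε⟩ := h₁ (ε / 2) (half_pos hε)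
    obtain ⟨L, hL, hLε⟩ := h₂ (ε / 2) (half_pos hε)
    refine ⟨K ∪ L, hK.union hL, fun x A B hAB => ?_⟩
    have hsub : ∀ {K'}, K' ⊆ K ∪ L →
        (Subtype.val '' A) ∩ setProduct K' (Subtype.val '' B) = ∅ := fun hK' =>
      subset_eq_empty (inter_subset_inter_right _ (setProduct_mono_left hK' _)) hAB
    rw [show restrict (ξ + η) x = restrict ξ x + restrict η x from rfl, map_add]
    refine (norm_add_le _ _).trans_lt ?_
    linarith [hKε x A B (hsub subset_union_left), hLε x A B (hsub subset_union_right)]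
  | basic ξ U hUo hU hξ =>
    let ζ : L2 X := ⟨restrictFamily ξ, restrictFamily_mem ξ⟩
    obtain ⟨η, hη⟩ := exists_restrict_approx (S ζ).2 hε
    -- With η approximating Sξ within ε, any arrow of supp η in the fibre of γ ∈ B ∩ supp ξ lies in
    -- this set times B, hence outside A.
    refine ⟨setProduct (tsupport η) (inverse '' tsupport ξ),
      isCompact_setProduct η.hasCompactSupport (IsCompact.image ξ.hasCompactSupport
        (LocallyCompactGroupoid.continuous_inverse (X := X))), fun x A B hAB => ?_⟩
    rw [ContinuousLinearMap.comp_apply, ContinuousLinearMap.comp_apply]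
    -- Since ξ lives on at most one arrow of the fibre, χ_B either fixes its restriction or kills
    -- it.
    by_cases hB : ∃ γ ∈ B, (γ : Arrows X) ∈ tsupport ξ
    · obtain ⟨γ, hγB, hγ⟩ := hB
      have h1 : chi B (restrict ξ x) = restrict ξ x := chi_eq_self fun δ hδ => by
        rwa [Subtype.ext (hU (hξ (subset_tsupport _ hδ)) (hξ hγ) (δ.2.trans γ.2.symm))]
      have h2 : chi A (restrict η x) = 0 := chi_eq_zero fun δ hδ => by
        by_contra h0
        exact hAB.subset ⟨mem_image_of_mem _ hδ, mem_setProduct_of_source_eq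
          (subset_tsupport _ h0) hγ (mem_image_of_mem _ hγB) (δ.2.trans γ.2.symm)⟩
      have h3 : T x (restrict ξ x) = sliceVector x (S ζ) := h x ζ
      -- As χ_A η = 0, the vector to estimate is χ_A(Sξ − η).
      rw [h1, h3, ← sub_zero (chi A _), ← h2, ← map_sub]
      exact (norm_chi_apply_le _ _).trans_lt (hη x)
    · have h1 : chi B (restrict ξ x) = 0 := chi_eq_zero fun γ hγ => by
        by_contra h0
        exact hB ⟨γ, hγ, subset_tsupport _ h0⟩
      rwa [h1, map_zero, map_zero, norm_zero]

/-- The slices of an adjoint are the adjoints of the slices. -/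
theorem IsSliceFamily.adjoint {S R : L2 X → L2 X} {T : ∀ x : X, ell2 x →L[ℂ] ell2 x}
    (h : IsSliceFamily S T) (hR : ∀ ξ η : L2 X, inner C₀(X, ℂ) η (S ξ) = inner C₀(X, ℂ) (R η) ξ) :
    IsSliceFamily R fun x => ContinuousLinearMap.adjoint (T x) := by
  intro x η
  -- Every basis vector is the restriction of a C_c function, so the module adjoint relation
  -- evaluated at x determines each coordinate.
  refine ext_inner_delta fun γ => ?_
  obtain ⟨ξ, hξ⟩ := exists_restrict_eq_delta (γ : Arrows X)
  let ζ : L2 X := ⟨restrictFamily ξ, restrictFamily_mem ξ⟩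
  have h1 : sliceVector x ζ = delta γ := hξ.self_of_nhds x γ.2
  have h2 : innerL2 η (S ζ) x = innerL2 (R η) ζ x := congrArg (fun f : C₀(X, ℂ) => f x) (hR ζ η)
  rw [innerL2_apply, innerL2_apply, ← h x ζ, h1] at h2
  rw [ContinuousLinearMap.adjoint_inner_left, h2]

end Topology

end EtaleGroupoid

/-! ### The equivalence -/

theorem theorem3p10 {X : Type u} [TopologicalSpace X] [CategoryTheory.Groupoid.{v} X]
    [TopologicalSpace (Arrows X)] [LocallyCompactEtaleGroupoid X]
    (T : ∀ x : X, ell2 x →L[ℂ] ell2 x) (hT : BddAbove (Set.range fun x => ‖T x‖)) :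
    (∃ S : L2 X → L2 X, IsAdjointable C₀(X, ℂ) S ∧ IsSliceFamily S T) ↔
      IsContinuousSection T ∧ IsVectorwiseUniformlyQuasiLocal T ∧
        IsVectorwiseUniformlyQuasiLocal (fun x => ContinuousLinearMap.adjoint (T x)) := by
  constructor
  · rintro ⟨S, ⟨R, hR⟩, hS⟩
    exact ⟨hS.isContinuousSection, hS.isVectorwiseUniformlyQuasiLocal,
      (hS.adjoint hR).isVectorwiseUniformlyQuasiLocal⟩
  · rintro ⟨hc, hq, hq'⟩
    obtain ⟨M, hM⟩ := hT
    -- The upper bound M may be negative when X is empty, whereas `familyMap` needs a nonnegative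
    -- bound.
    have hTM : ∀ x, ‖T x‖ ≤ max M 0 := fun x => (hM ⟨x, rfl⟩).trans (le_max_left _ _)
    have hTM' : ∀ x, ‖ContinuousLinearMap.adjoint (T x)‖ ≤ max M 0 := fun x =>
      (LinearIsometryEquiv.norm_map _ _).le.trans (hTM x)
    have h0 : 0 ≤ max M 0 := le_max_right _ _
    refine ⟨fun ξ => ⟨_, familyMap_mem_L2 h0 hTM hc hq ξ.2⟩,
      ⟨fun η => ⟨_, familyMap_mem_L2 h0 hTM' (isContinuousSection_adjoint hc) hq' η.2⟩,
        fun ξ η => ?_⟩, fun x ξ => rfl⟩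
    ext x
    change innerL2 _ _ x = innerL2 _ _ x
    rw [innerL2_apply, innerL2_apply]
    exact (ContinuousLinearMap.adjoint_inner_left (T x) _ _).symm
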